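/- Conventions. Rings are associative with $1$. A ring $A$ containing a ring $R$ is a \emph{quasi-commutative skew PBW extension} of $R$ in the variables $x_1,\dots,x_n\in A$, written $A=\sigma(R)\langle x_1,\dots,x_n\rangle$, if $A$ is a free left $R$-module with basis the monomials $x^t=x_1^{t_1}\cdots x_n^{t_n}$, $t\in\mathbb N^n$; for all $1\le i\le n$ and $r\in R\setminus\{0\}$ there is $c_{i,r}\in R\setminus\{0\}$ with $x_ir=c_{i,r}x_i$; and for all $1\le i,j\le n$ there is $c_{j,i}\in R\setminus\{0\}$ with $x_jx_i=c_{j,i}x_ix_j$. Its endomorphisms $\sigma_i$ are the injective ring endomorphisms of $R$ with $x_ir=\sigma_i(r)x_i$ for all $r\in R$. A \emph{left Ore domain} is a (not necessarily commutative) domain in which any two nonzero elements have a nonzero common left multiple. \textbf{Theorem.} Let $A=\sigma(R)\langle x_1,\dots,x_n\rangle$ be a quasi-commutative skew PBW extension of a left Ore domain $R$ and let $S=R\setminus\{0\}$. Then $A$ has endomorphisms $\sigma_i$ and nonzero constants $c_{j,i}$ as above, $S$ is a left Ore set in $R$ and in $A$, so that the rings of left fractions $S^{-1}R$ and $S^{-1}A$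 exist, and: (1) There is a well-defined ring homomorphism $S^{-1}R\to S^{-1}A$, $\frac as\mapsto\frac as$; it is injective, and, with $S^{-1}R$ viewed in $S^{-1}A$ through it, $S^{-1}A$ is a quasi-commutative skew PBW extension of $S^{-1}R$ in the variables $\frac{x_1}1,\dots,\frac{x_n}1$. (2) The endomorphisms of this extension are the well-defined injective ring endomorphisms $$\overline{\sigma_i}:S^{-1}R\to S^{-1}R,\qquad \frac as\mapsto\frac{\sigma_i(a)}{\sigma_i(s)},$$ and its constants are $\frac{c_{j,i}}1$, that is, $\frac{x_j}1\frac{x_i}1=\frac{c_{j,i}}1\,\frac{x_i}1\frac{x_j}1$ for all $1\le i,j\le n$. (3) $S^{-1}A\cong\sigma(S^{-1}R)\langle y_1,\dots,y_n\rangle$ for every quasi-commutative skew PBW extension of $S^{-1}R$ in variables $y_1,\dots,y_n$ with endomorphisms $\overline{\sigma_i}$ and constants $\frac{c_{j,i}}1$: there is exactly one ring isomorphism that is the identity on $S^{-1}R$ and takes $\frac{x_i}1$ to $y_i$ for all $i$. (4) The canonical homomorphism $\psi:A\to S^{-1}A$ is given by $$\psi\Big(\sum_t a_tx^t\Big)=\sum_t\frac{a_t}1\Big(\frac{x_1}1\Big)^{t_1}\cdots\Big(\frac{x_n}1\Big)^{t_n}.$$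 It has the universal property of $S^{-1}A$: it takes every $s\in S$ to a unit, and every ring homomorphism $f:A\to T$ taking every $s\in S$ to a unit factors uniquely through $\psi$. -/

import Mathlib

open OreLocalization

/-- The ordered monomial `x^t = x_1^{t_1} ⋯ x_n^{t_n}`. -/
def pbwMonomial {A : Type*} [Ring A] {n : ℕ} (x : Fin n → A) (t : Fin n → ℕ) : A :=
  (List.ofFn fun i => x i ^ t i).prod

/-- `A` is a quasi-commutative skew PBW extension of `R` in the variables `x_1, …, x_n`. The
inclusion of `R` in `A` is the injective ring homomorphism `ι`, and `A` is a left `R`-module by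
`r • a = ι r * a`. -/
structure IsQuasiCommSkewPBW {R A : Type*} [Ring R] [Ring A] {n : ℕ}
    (ι : R →+* A) (x : Fin n → A) : Prop where
  injective : Function.Injective ι
  /-- The family of monomials `x^t`, `t ∈ ℕ^n`, is left linearly independent over `R`. -/
  linearIndependent :
    letI : Module R A := Module.compHom A ι
    LinearIndependent R (pbwMonomial x)
  /-- The monomials `x^t`, `t ∈ ℕ^n`, span `A` as a left `R`-module. -/
  span_eq_top :
    letI : Module R A := Module.compHom A ι
    Submodule.span R (Set.range (pbwMonomial x)) = ⊤
  exists_coeff : ∀ (i : Fin n) (r : R), r ≠ 0 → ∃ c : R, c ≠ 0 ∧ x i * ι r = ι c * x i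
  exists_const : ∀ i j : Fin n, ∃ c : R, c ≠ 0 ∧ x j * x i = ι c * (x i * x j)

/-- `σ_1, …, σ_n` are the endomorphisms of the quasi-commutative skew PBW extension given by `ι`
and `x`, and the `c j i` are its constants: `x_i r = σ_i(r) x_i` and `x_j x_i = c_{j,i} x_i x_j`.
Because the monomials form a basis, these equations determine `σ` and `c`. -/
structure HasPBWParameters {R A : Type*} [Ring R] [Ring A] {n : ℕ}
    (ι : R →+* A) (x : Fin n → A) (σ : Fin n → R →+* R) (c : Fin n → Fin n → R) : Prop where
  endo_injective : ∀ i, Function.Injective (σ i)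
  mul_coeff : ∀ i r, x i * ι r = ι (σ i r) * x i
  const_ne_zero : ∀ j i, c j i ≠ 0
  mul_var : ∀ j i, x j * x i = ι (c j i) * (x i * x j)

/-- A left Ore domain: a (not necessarily commutative) domain in which any two nonzero elements
have a nonzero common left multiple. -/
class IsLeftOreDomain (R : Type*) [Ring R] : Prop extends IsDomain R where
  exists_common_multiple : ∀ a b : R, a ≠ 0 → b ≠ 0 → ∃ r s : R, r * a = s * b ∧ r * a ≠ 0

/-- The multiplicative set `S = R ∖ {0}` of a domain `R`. -/
def nonzeroElements (R : Type*) [Ring R] [IsDomain R] : Submonoid R where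
  carrier := {r | r ≠ 0}
  one_mem' := one_ne_zero
  mul_mem' := fun ha hb => mul_ne_zero ha hb

/-- The set `S = R ∖ {0}`, viewed inside an overring `A` of `R` by means of `ι : R → A`. -/
def nonzeroElementsIn {R A : Type*} [Ring R] [IsDomain R] [Ring A] (ι : R →+* A) :
    Submonoid A :=
  (nonzeroElements R).map ι

/-- The element `ι s` of `S ⊆ A`, for `s ∈ S ⊆ R`. -/
def inclDenom {R A : Type*} [Ring R] [IsDomain R] [Ring A] (ι : R →+* A)
    (s : nonzeroElements R) : nonzeroElementsIn ι :=
  ⟨ι s, Submonoid.mem_map_of_mem ι s.2⟩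

/-- The element `f s` of `S`, for `s ∈ S` and an injective endomorphism `f` of `R`. -/
def endoDenom {R : Type*} [Ring R] [IsDomain R] (f : R →+* R) (hf : Function.Injective f)
    (s : nonzeroElements R) : nonzeroElements R :=
  ⟨f s, (map_ne_zero_iff f hf).2 s.2⟩

/-! ### Polynomials with left coefficients -/

section PBWSum

variable {R A B : Type*} [Ring R] [Ring A] [Ring B] {n : ℕ}

/-! Freeness over `R` says that `pbwSum` is bijective, so every claim becomes one about
coefficients. Since `x^t r = τ_t(r) x^t` with `τ_t` injective, elements of `S` are regular in `A`,
and the Ore condition holds monomial by monomial; common left multiples in `R` then handle sums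
(`exists_leftMultiple`). The universal property yields `j` and the `σ'_i`; commutation rules extend
to fractions by cancelling units. Finitely many fractions have a common left denominator
(`exists_common_denominator`), so a relation among monomials over `S⁻¹R` clears to one over `R`,
while `s⁻¹a` has the coefficients of `a` multiplied by `s⁻¹`. Two extensions with equal parameters
are compared through the subring of `A × B` of polynomials in the pairs `(x_i, y_i)`: it is the
graph of the isomorphism. -/

theorem pbwMonomial_cons {n : ℕ} (x : Fin (n + 1) → A) (t : Fin (n + 1) → ℕ) :
    pbwMonomial x t = x 0 ^ t 0 * pbwMonomial (fun i => x i.succ) (fun i => t i.succ) := by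
  simp [pbwMonomial, List.ofFn_succ]

theorem pbwMonomial_zero (x : Fin n → A) : pbwMonomial x 0 = 1 := by
  induction n with
  | zero => simp [pbwMonomial]
  | succ n ih =>
    rw [pbwMonomial_cons]
    simp only [Pi.zero_apply, pow_zero, one_mul]
    exact ih fun i => x i.succ

theorem map_pbwMonomial (φ : A →+* B) (x : Fin n → A) (t : Fin n → ℕ) :
    φ (pbwMonomial x t) = pbwMonomial (fun i => φ (x i)) t := by
  simp [pbwMonomial, map_list_prod, List.map_ofFn, Function.comp_def]

/-- The polynomial `∑ a_t x^t` with coefficients `a_t` in `R`. -/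
noncomputable def pbwSum (ι : R →+* A) (x : Fin n → A) : ((Fin n → ℕ) →₀ R) →+ A :=
  Finsupp.liftAddHom fun t => (AddMonoidHom.mulRight (pbwMonomial x t)).comp ι.toAddMonoidHom

theorem pbwSum_apply (ι : R →+* A) (x : Fin n → A) (f : (Fin n → ℕ) →₀ R) :
    pbwSum ι x f = f.sum fun t r => ι r * pbwMonomial x t := rfl

@[simp]
theorem pbwSum_single (ι : R →+* A) (x : Fin n → A) (t : Fin n → ℕ) (r : R) :
    pbwSum ι x (Finsupp.single t r) = ι r * pbwMonomial x t := by
  simp [pbwSum]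

theorem map_pbwSum (φ : A →+* B) (ι : R →+* A) (x : Fin n → A) (f : (Fin n → ℕ) →₀ R) :
    φ (pbwSum ι x f) = pbwSum (φ.comp ι) (fun i => φ (x i)) f := by
  simp [pbwSum_apply, Finsupp.sum, map_pbwMonomial]

theorem mul_pbwSum (ι : R →+* A) (x : Fin n → A) (r : R) (f : (Fin n → ℕ) →₀ R) :
    ι r * pbwSum ι x f = pbwSum ι x (f.mapRange (r * ·) (mul_zero r)) := by
  rw [pbwSum_apply, pbwSum_apply, Finsupp.sum_mapRange_index (by simp), Finsupp.mul_sum]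
  simp [mul_assoc]

theorem pbwSum_comp {Q : Type*} [Ring Q] (g : R →+* Q) (k : Q →+* B) (y : Fin n → B)
    (f : (Fin n → ℕ) →₀ R) :
    pbwSum (k.comp g) y f = pbwSum k y (f.mapRange g (map_zero g)) := by
  rw [pbwSum_apply, pbwSum_apply, Finsupp.sum_mapRange_index (by simp)]
  simp

theorem linearIndependent_pbwMonomial_iff (ι : R →+* A) (x : Fin n → A) :
    (letI : Module R A := Module.compHom A ι
     LinearIndependent R (pbwMonomial x)) ↔ ∀ f, pbwSum ι x f = 0 → f = 0 := by
  let : Module R A := Module.compHom A ι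
  exact linearIndependent_iff

theorem span_pbwMonomial_iff (ι : R →+* A) (x : Fin n → A) :
    (letI : Module R A := Module.compHom A ι
     Submodule.span R (Set.range (pbwMonomial x)) = ⊤) ↔ ∀ a, ∃ f, pbwSum ι x f = a := by
  let : Module R A := Module.compHom A ι
  simp only [Submodule.eq_top_iff', Finsupp.mem_span_range_iff_exists_finsupp]
  rfl

end PBWSum

/-! ### Endomorphisms, constants and uniqueness of the extension -/

section Parameters

variable {R A B : Type*} [Ring R] [Ring A] [Ring B] {n : ℕ}

namespace IsQuasiCommSkewPBW

variable {ι : R →+* A} {x : Fin n → A}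

theorem pbwSum_injective (h : IsQuasiCommSkewPBW ι x) : Function.Injective (pbwSum ι x) :=
  (injective_iff_map_eq_zero _).2 ((linearIndependent_pbwMonomial_iff ι x).1 h.linearIndependent)

theorem pbwSum_surjective (h : IsQuasiCommSkewPBW ι x) : Function.Surjective (pbwSum ι x) :=
  (span_pbwMonomial_iff ι x).1 h.span_eq_top

theorem eq_of_mul_pbwMonomial_eq (h : IsQuasiCommSkewPBW ι x) {t : Fin n → ℕ} {r s : R}
    (hrs : ι r * pbwMonomial x t = ι s * pbwMonomial x t) : r = s := by
  rw [← pbwSum_single, ← pbwSum_single] at hrs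
  exact Finsupp.single_injective t (h.pbwSum_injective hrs)

end IsQuasiCommSkewPBW

theorem pbwMonomial_single (x : Fin n → A) (i : Fin n) :
    pbwMonomial x (Pi.single i 1) = x i := by
  induction n with
  | zero => exact i.elim0
  | succ n ih =>
    rw [pbwMonomial_cons]
    cases i using Fin.cases with
    | zero =>
      have : (fun i : Fin n => (Pi.single 0 1 : Fin (n + 1) → ℕ) i.succ) = 0 := by
        ext i; simp
      rw [this, pbwMonomial_zero]; simp
    | succ i =>
      have : (fun k : Fin n => (Pi.single i.succ 1 : Fin (n + 1) → ℕ) k.succ) = Pi.single i 1 := by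
        ext k; simp [Pi.single_apply]
      rw [this, ih]; simp

theorem IsQuasiCommSkewPBW.eq_of_mul_var_eq {ι : R →+* A} {x : Fin n → A}
    (h : IsQuasiCommSkewPBW ι x) {i : Fin n} {r s : R} (hrs : ι r * x i = ι s * x i) : r = s := by
  rw [← pbwMonomial_single x i] at hrs
  exact h.eq_of_mul_pbwMonomial_eq hrs

/-- Coefficients of `x_i` are unique, so additivity and multiplicativity of `σ_i` follow by
comparing both sides after right multiplication by `x_i`. -/
theorem IsQuasiCommSkewPBW.exists_parameters {ι : R →+* A} {x : Fin n → A}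
    (h : IsQuasiCommSkewPBW ι x) :
    ∃ (σ : Fin n → R →+* R) (c : Fin n → Fin n → R), HasPBWParameters ι x σ c := by
  have h1 : ∀ (i : Fin n) (r : R), ∃ c : R, (r ≠ 0 → c ≠ 0) ∧ x i * ι r = ι c * x i := by
    intro i r
    by_cases hr : r = 0
    · exact ⟨0, by simp [hr], by simp [hr]⟩
    · obtain ⟨c, hc, hx⟩ := h.exists_coeff i r hr
      exact ⟨c, fun _ => hc, hx⟩
  choose σ hσ0 hσ using h1
  choose c hc0 hc using h.exists_const
  refine ⟨fun i =>
    { toFun := σ i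
      map_one' := h.eq_of_mul_var_eq (i := i) (by rw [← hσ]; simp)
      map_zero' := h.eq_of_mul_var_eq (i := i) (by rw [← hσ]; simp)
      map_mul' := fun a b => h.eq_of_mul_var_eq (i := i) (by
        rw [← hσ, map_mul, map_mul, ← mul_assoc, hσ, mul_assoc, hσ, mul_assoc])
      map_add' := fun a b => h.eq_of_mul_var_eq (i := i) (by
        rw [← hσ, map_add, map_add, mul_add, hσ, hσ, add_mul]) },
    -- The indices are swapped because `exists_const` chooses its constant in the order `i j`.
    fun j i => c i j, fun i => ?_, hσ, fun j i => hc0 i j, fun j i => hc i j⟩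
  rw [injective_iff_map_eq_zero]
  intro a ha
  by_contra h0
  exact hσ0 i a h0 ha

namespace HasPBWParameters

variable {ι : R →+* A} {σ : Fin n → R →+* R} {c : Fin n → Fin n → R}

theorem tail {n : ℕ} {x : Fin (n + 1) → A} {σ : Fin (n + 1) → R →+* R}
    {c : Fin (n + 1) → Fin (n + 1) → R} (h : HasPBWParameters ι x σ c) :
    HasPBWParameters ι (fun i : Fin n => x i.succ) (fun i => σ i.succ)
      (fun i k => c i.succ k.succ) :=
  ⟨fun _ => h.endo_injective _, fun _ => h.mul_coeff _, fun _ _ => h.const_ne_zero _ _,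
    fun _ _ => h.mul_var _ _⟩

variable {x : Fin n → A}

theorem prod (h : HasPBWParameters ι x σ c) {k : R →+* B} {y : Fin n → B}
    (h' : HasPBWParameters k y σ c) :
    HasPBWParameters (ι.prod k) (fun i => (x i, y i)) σ c :=
  ⟨h.endo_injective, fun i r => Prod.ext (h.mul_coeff i r) (h'.mul_coeff i r), h.const_ne_zero,
    fun i k => Prod.ext (h.mul_var i k) (h'.mul_var i k)⟩

theorem pow_mul_coeff (h : HasPBWParameters ι x σ c) (i : Fin n) (m : ℕ) (r : R) :
    x i ^ m * ι r = ι ((σ i)^[m] r) * x i ^ m := by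
  induction m generalizing r with
  | zero => simp
  | succ m ih =>
    rw [pow_succ, mul_assoc, h.mul_coeff, ← mul_assoc, ih, mul_assoc, Function.iterate_succ_apply]

/-- `τ` is a composite of powers of the `σ_i`; its injectivity will keep `τ s` nonzero for `s ≠ 0`.
-/
theorem exists_pbwMonomial_mul_coeff (h : HasPBWParameters ι x σ c) (t : Fin n → ℕ) :
    ∃ τ : R → R, Function.Injective τ ∧
      ∀ r, pbwMonomial x t * ι r = ι (τ r) * pbwMonomial x t := by
  induction n with
  | zero => exact ⟨id, Function.injective_id, by simp [pbwMonomial]⟩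
  | succ n ih =>
    obtain ⟨τ, hτ, hx⟩ := ih h.tail fun i => t i.succ
    refine ⟨(σ 0)^[t 0] ∘ τ, ((h.endo_injective 0).iterate _).comp hτ, fun r => ?_⟩
    rw [pbwMonomial_cons, mul_assoc, hx, ← mul_assoc, h.pow_mul_coeff, mul_assoc]
    rfl

theorem exists_mul_var_pow (h : HasPBWParameters ι x σ c) (i k : Fin n) (m : ℕ) :
    ∃ d : R, x i * x k ^ m = ι d * (x k ^ m * x i) := by
  induction m with
  | zero => exact ⟨1, by simp⟩
  | succ m ih =>
    obtain ⟨d, hd⟩ := ih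
    refine ⟨d * (σ k)^[m] (c i k), ?_⟩
    rw [pow_succ, ← mul_assoc, hd, mul_assoc, mul_assoc, h.mul_var, ← mul_assoc (x k ^ m),
      h.pow_mul_coeff, map_mul]
    simp only [mul_assoc]

theorem exists_var_mul_pbwMonomial (h : HasPBWParameters ι x σ c) (i : Fin n) (t : Fin n → ℕ) :
    ∃ d : R, x i * pbwMonomial x t = ι d * pbwMonomial x (t + Pi.single i 1) := by
  induction n with
  | zero => exact i.elim0
  | succ n ih =>
    rw [pbwMonomial_cons, pbwMonomial_cons]
    cases i using Fin.cases with
    | zero =>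
      have : (fun i : Fin n => (t + Pi.single 0 1 : Fin (n + 1) → ℕ) i.succ)
          = fun i => t i.succ := by
        ext i; simp
      refine ⟨1, ?_⟩
      rw [this, ← mul_assoc, ← pow_succ']; simp
    | succ i =>
      have : (fun k : Fin n => (t + Pi.single i.succ 1 : Fin (n + 1) → ℕ) k.succ)
          = (fun k => t k.succ) + Pi.single i 1 := by
        ext k; simp [Pi.single_apply]
      obtain ⟨d, hd⟩ := h.exists_mul_var_pow i.succ 0 (t 0)
      obtain ⟨e, he⟩ := ih h.tail i fun k => t k.succ
      refine ⟨d * (σ 0)^[t 0] e, ?_⟩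
      rw [this, ← mul_assoc, hd, mul_assoc, mul_assoc, he, ← mul_assoc (x 0 ^ t 0),
        h.pow_mul_coeff, map_mul]
      simp [mul_assoc]

theorem var_mul_mem_range (h : HasPBWParameters ι x σ c) (i : Fin n) {a : A}
    (ha : a ∈ (pbwSum ι x).range) : x i * a ∈ (pbwSum ι x).range := by
  obtain ⟨f, rfl⟩ := ha
  induction f using Finsupp.induction_linear with
  | zero => simp
  | add f g hf hg => rw [map_add, mul_add]; exact add_mem hf hg
  | single t r =>
    obtain ⟨d, hd⟩ := h.exists_var_mul_pbwMonomial i t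
    exact ⟨Finsupp.single (t + Pi.single i 1) (σ i r * d), by
      rw [pbwSum_single, pbwSum_single, ← mul_assoc, h.mul_coeff, mul_assoc, hd, map_mul,
        mul_assoc]⟩

theorem coeff_mul_mem_range (ι : R →+* A) (x : Fin n → A) (r : R) {a : A}
    (ha : a ∈ (pbwSum ι x).range) : ι r * a ∈ (pbwSum ι x).range := by
  obtain ⟨f, rfl⟩ := ha
  exact ⟨_, (mul_pbwSum ι x r f).symm⟩

theorem pbwMonomial_mul_mem_range (h : HasPBWParameters ι x σ c) (t : Fin n → ℕ) {a : A}
    (ha : a ∈ (pbwSum ι x).range) : pbwMonomial x t * a ∈ (pbwSum ι x).range := by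
  have hpow : ∀ (i : Fin n) (m : ℕ) (b : A), b ∈ (pbwSum ι x).range →
      x i ^ m * b ∈ (pbwSum ι x).range := by
    intro i m
    induction m with
    | zero => simp
    | succ m ih =>
      intro b hb
      rw [pow_succ, mul_assoc]
      exact ih _ (h.var_mul_mem_range i hb)
  have hlist : ∀ l : List A, (∀ z ∈ l, ∀ b ∈ (pbwSum ι x).range, z * b ∈ (pbwSum ι x).range) →
      l.prod * a ∈ (pbwSum ι x).range := by
    intro l hl
    induction l with
    | nil => simpa using ha
    | cons z l ih =>
      rw [List.prod_cons, mul_assoc]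
      exact hl z (by simp) _ (ih fun w hw => hl w (by simp [hw]))
  refine hlist _ fun z hz b hb => ?_
  obtain ⟨i, rfl⟩ := List.mem_ofFn.1 hz
  exact hpow i _ b hb

/-- Only the commutation rules enter, not freeness or spanning, so this applies inside `A × B`. -/
theorem mul_mem_range (h : HasPBWParameters ι x σ c) {a b : A}
    (ha : a ∈ (pbwSum ι x).range) (hb : b ∈ (pbwSum ι x).range) :
    a * b ∈ (pbwSum ι x).range := by
  obtain ⟨f, rfl⟩ := ha
  induction f using Finsupp.induction_linear with
  | zero => simp
  | add f g hf hg => rw [map_add, add_mul]; exact add_mem hf hg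
  | single t r =>
    rw [pbwSum_single, mul_assoc]
    exact coeff_mul_mem_range ι x r (h.pbwMonomial_mul_mem_range t hb)

/-- The subring of polynomials `∑ a_t x^t`. -/
noncomputable def subring (h : HasPBWParameters ι x σ c) : Subring A :=
  { (pbwSum ι x).range with
    one_mem' := ⟨Finsupp.single 0 1, by simp [pbwMonomial_zero]⟩
    mul_mem' := h.mul_mem_range }

theorem mem_subring (h : HasPBWParameters ι x σ c) {a : A} :
    a ∈ h.subring ↔ ∃ f, pbwSum ι x f = a := Iff.rfl

end HasPBWParameters

/-- `φ` preserves coefficients, and in `A` these exist and are unique. -/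
theorem IsQuasiCommSkewPBW.bijective_of_comp {C : Type*} [Ring C] {ι : R →+* A} {x : Fin n → A}
    (h : IsQuasiCommSkewPBW ι x) {κ : R →+* C} {z : Fin n → C}
    (φ : C →+* A) (hκ : φ.comp κ = ι) (hz : (fun i => φ (z i)) = x)
    (hspan : ∀ a, ∃ f, pbwSum κ z f = a) : Function.Bijective φ := by
  have key : ∀ f, φ (pbwSum κ z f) = pbwSum ι x f := fun f => by rw [map_pbwSum, hκ, hz]
  constructor
  · rw [injective_iff_map_eq_zero]
    intro a ha
    obtain ⟨f, rfl⟩ := hspan a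
    rw [key, map_eq_zero_iff _ h.pbwSum_injective] at ha
    rw [ha, map_zero]
  · intro a
    obtain ⟨f, rfl⟩ := h.pbwSum_surjective a
    exact ⟨_, key f⟩

/-- Two quasi-commutative skew PBW extensions of `R` with the same parameters are isomorphic over
`R`, by a unique isomorphism matching the variables. -/
theorem IsQuasiCommSkewPBW.existsUnique_ringEquiv {ι : R →+* A} {x : Fin n → A}
    {k : R →+* B} {y : Fin n → B} {σ : Fin n → R →+* R} {c : Fin n → Fin n → R}
    (hx : IsQuasiCommSkewPBW ι x) (hy : IsQuasiCommSkewPBW k y)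
    (hxp : HasPBWParameters ι x σ c) (hyp : HasPBWParameters k y σ c) :
    ∃! Φ : A ≃+* B, (∀ q, Φ (ι q) = k q) ∧ ∀ i, Φ (x i) = y i := by
  -- Equal parameters let the pairs satisfy the same rules; both projections of the resulting
  -- subring are bijective.
  have hp := hxp.prod hyp
  have hι : ∀ r, ι.prod k r ∈ hp.subring := fun r =>
    hp.mem_subring.2 ⟨Finsupp.single 0 r, by simp [pbwMonomial_zero]⟩
  have hv : ∀ i, (x i, y i) ∈ hp.subring := fun i =>
    hp.mem_subring.2 ⟨Finsupp.single (Pi.single i 1) 1, by simp [pbwMonomial_single]⟩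
  let κ : R →+* hp.subring := (ι.prod k).codRestrict hp.subring hι
  let z : Fin n → hp.subring := fun i => ⟨(x i, y i), hv i⟩
  have hspan : ∀ a, ∃ f, pbwSum κ z f = a := by
    rintro ⟨a, ha⟩
    obtain ⟨f, hf⟩ := hp.mem_subring.1 ha
    refine ⟨f, Subtype.ext ?_⟩
    exact (map_pbwSum hp.subring.subtype κ z f).trans hf
  let p : hp.subring ≃+* A := RingEquiv.ofBijective
    ((RingHom.fst A B).comp hp.subring.subtype) (hx.bijective_of_comp _ rfl rfl hspan)
  let q : hp.subring ≃+* B := RingEquiv.ofBijective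
    ((RingHom.snd A B).comp hp.subring.subtype) (hy.bijective_of_comp _ rfl rfl hspan)
  refine ⟨p.symm.trans q, ⟨fun r => ?_, fun i => ?_⟩, ?_⟩
  · have : p.symm (ι r) = κ r := p.symm_apply_eq.2 rfl
    rw [RingEquiv.trans_apply, this]; rfl
  · have : p.symm (x i) = z i := p.symm_apply_eq.2 rfl
    rw [RingEquiv.trans_apply, this]; rfl
  · have key : ∀ Ψ : A ≃+* B, ((∀ q, Ψ (ι q) = k q) ∧ ∀ i, Ψ (x i) = y i) →
        ∀ f, Ψ (pbwSum ι x f) = pbwSum k y f := by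
      intro Ψ hΨ f
      have := map_pbwSum (Ψ : A →+* B) ι x f
      rwa [show ((Ψ : A →+* B).comp ι) = k from RingHom.ext hΨ.1,
        show (fun i => (Ψ : A →+* B) (x i)) = y from funext hΨ.2] at this
    intro Ψ hΨ
    ext a
    obtain ⟨f, rfl⟩ := hx.pbwSum_surjective a
    rw [key Ψ hΨ]
    symm
    apply key
    refine ⟨fun r => ?_, fun i => ?_⟩
    · have : p.symm (ι r) = κ r := p.symm_apply_eq.2 rfl
      rw [RingEquiv.trans_apply, this]; rfl
    · have : p.symm (x i) = z i := p.symm_apply_eq.2 rfl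
      rw [RingEquiv.trans_apply, this]; rfl

end Parameters

theorem exists_leftMultiple {R : Type*} [Ring R] [IsLeftOreDomain R] (a : R) {b : R}
    (hb : b ≠ 0) : ∃ r s : R, r ≠ 0 ∧ r * a = s * b := by
  by_cases ha : a = 0
  · exact ⟨1, 0, one_ne_zero, by simp [ha]⟩
  · obtain ⟨r, s, h, h0⟩ := IsLeftOreDomain.exists_common_multiple a b ha hb
    exact ⟨r, s, left_ne_zero_of_mul h0, h⟩

theorem nonempty_oreSet_nonzeroElements (R : Type*) [Ring R] [IsLeftOreDomain R] :
    Nonempty (OreSet (nonzeroElements R)) := by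
  refine nonempty_oreSet_iff_of_noZeroDivisors.2 fun a s => ?_
  obtain ⟨r, t, hr, h⟩ := exists_leftMultiple a s.2
  exact ⟨t, ⟨r, hr⟩, h⟩

/-! ### The Ore condition in `A` -/

section OreInExtension

variable {R A : Type*} [Ring R] [Ring A] {n : ℕ} {ι : R →+* A} {x : Fin n → A}

theorem IsQuasiCommSkewPBW.eq_zero_of_coeff_mul [IsDomain R] (h : IsQuasiCommSkewPBW ι x)
    {s : R} (hs : s ≠ 0) {a : A} (ha : ι s * a = 0) : a = 0 := by
  obtain ⟨f, rfl⟩ := h.pbwSum_surjective a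
  rw [mul_pbwSum, map_eq_zero_iff _ h.pbwSum_injective] at ha
  have : f = 0 := by
    ext t
    have := DFunLike.congr_fun ha t
    simpa [hs] using this
  rw [this, map_zero]

theorem IsQuasiCommSkewPBW.eq_zero_of_mul_coeff [IsDomain R] (h : IsQuasiCommSkewPBW ι x)
    {σ : Fin n → R →+* R} {c : Fin n → Fin n → R} (hp : HasPBWParameters ι x σ c)
    {s : R} (hs : s ≠ 0) {a : A} (ha : a * ι s = 0) : a = 0 := by
  obtain ⟨f, rfl⟩ := h.pbwSum_surjective a
  choose τ hτ hτx using hp.exists_pbwMonomial_mul_coeff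
  have hτ0 : ∀ t, τ t s ≠ 0 := by
    intro t h0
    refine hs (hτ t (h0.trans (h.eq_of_mul_pbwMonomial_eq (t := t) ?_)))
    rw [← hτx]; simp
  -- The coefficients of `a s`: each `f t` is multiplied by the nonzero `τ t s`.
  let g : (Fin n → ℕ) →₀ R := Finsupp.onFinset f.support (fun t => f t * τ t s) (by
    intro t ht
    exact Finsupp.mem_support_iff.2 (left_ne_zero_of_mul ht))
  have hg : pbwSum ι x g = pbwSum ι x f * ι s := by
    rw [pbwSum_apply, pbwSum_apply, Finsupp.onFinset_sum _ (by simp), Finsupp.sum,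
      Finset.sum_mul]
    refine Finset.sum_congr rfl fun t _ => ?_
    rw [mul_assoc, hτx, map_mul, mul_assoc]
  rw [ha, map_eq_zero_iff _ h.pbwSum_injective] at hg
  have : f = 0 := by
    ext t
    have := DFunLike.congr_fun hg t
    simpa [g, hτ0 t] using this
  rw [this, map_zero]

theorem IsQuasiCommSkewPBW.exists_leftMultiple [IsLeftOreDomain R] (h : IsQuasiCommSkewPBW ι x)
    {σ : Fin n → R →+* R} {c : Fin n → Fin n → R} (hp : HasPBWParameters ι x σ c)
    {s : R} (hs : s ≠ 0) (a : A) : ∃ r ≠ 0, ∃ b, ι r * a = b * ι s := by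
  obtain ⟨f, rfl⟩ := h.pbwSum_surjective a
  induction f using Finsupp.induction_linear with
  | zero => exact ⟨1, one_ne_zero, 0, by simp⟩
  | add f g hf hg =>
    obtain ⟨r₁, hr₁, b₁, h₁⟩ := hf
    obtain ⟨r₂, hr₂, b₂, h₂⟩ := hg
    -- `u r₁ = v r₂` is a multiplier that works for both summands.
    obtain ⟨u, v, huv, hu⟩ := IsLeftOreDomain.exists_common_multiple r₁ r₂ hr₁ hr₂
    refine ⟨u * r₁, hu, ι u * b₁ + ι v * b₂, ?_⟩
    rw [map_add, mul_add, add_mul, mul_assoc, mul_assoc, ← h₁, ← h₂, ← mul_assoc, ← mul_assoc,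
      ← map_mul, ← map_mul, huv]
  | single t r =>
    obtain ⟨τ, hτ, hτx⟩ := hp.exists_pbwMonomial_mul_coeff t
    have hτ0 : τ s ≠ 0 := by
      intro h0
      refine hs (hτ (h0.trans (h.eq_of_mul_pbwMonomial_eq (t := t) ?_)))
      rw [← hτx]; simp
    -- From `u r = v τ(s)` follows `u r x^t = v τ(s) x^t = (v x^t) s`.
    obtain ⟨u, v, hu, huv⟩ := _root_.exists_leftMultiple r hτ0
    refine ⟨u, hu, ι v * pbwMonomial x t, ?_⟩
    rw [pbwSum_single, mul_assoc, hτx, ← mul_assoc, ← mul_assoc, ← map_mul, ← map_mul, huv]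

theorem IsQuasiCommSkewPBW.nonempty_oreSet [IsLeftOreDomain R] (h : IsQuasiCommSkewPBW ι x)
    {σ : Fin n → R →+* R} {c : Fin n → Fin n → R} (hp : HasPBWParameters ι x σ c) :
    Nonempty (OreSet (nonzeroElementsIn ι)) := by
  refine nonempty_oreSet_iff.2 ⟨?_, ?_⟩
  · rintro a b ⟨_, s, hs, rfl⟩ hab
    -- `s` cancels on the right, so no extra left factor is needed.
    refine ⟨1, ?_⟩
    have : a - b = 0 := h.eq_zero_of_mul_coeff hp hs (by rw [sub_mul]; exact sub_eq_zero.2 hab)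
    rw [sub_eq_zero.1 this]
  · rintro a ⟨_, s, hs, rfl⟩
    obtain ⟨r, hr, b, hb⟩ := h.exists_leftMultiple hp hs a
    exact ⟨b, inclDenom ι ⟨r, hr⟩, hb⟩

end OreInExtension

/-! ### Left fractions and common denominators -/

namespace OreLocalization

variable {R T : Type*} [Ring R] [Ring T] {S : Submonoid R} [OreSet S]

theorem numeratorRingHom_mul_oreDiv (a : R) (s : S) :
    (numeratorRingHom (s : R) : OreLocalization S R) * (a /ₒ s) = numeratorRingHom a :=
  OreLocalization.mul_cancel

theorem isUnit_numeratorRingHom (s : S) :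
    IsUnit (numeratorRingHom (s : R) : OreLocalization S R) :=
  numerator_isUnit s

theorem exists_numeratorRingHom_mul_eq (q : OreLocalization S R) :
    ∃ (s : S) (a : R), (numeratorRingHom (s : R) : OreLocalization S R) * q = numeratorRingHom a := by
  induction q with | _ a s
  exact ⟨s, a, numeratorRingHom_mul_oreDiv a s⟩

theorem existsUnique_comp_numeratorRingHom (f : R →+* T) (hf : ∀ s ∈ S, IsUnit (f s)) :
    ∃! g : OreLocalization S R →+* T, g.comp numeratorRingHom = f := by
  choose u hu using hf
  let fS : S →* Tˣ :=
    { toFun := fun s => u s s.2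
      map_one' := Units.ext (by simp [hu])
      map_mul' := fun a b => Units.ext (by simp [hu]) }
  have hfS : ∀ s : S, f s = fS s := fun s => (hu s s.2).symm
  refine ⟨universalHom f fS hfS, ?_, fun g hg => ?_⟩
  · ext r
    exact universalHom_commutes f fS hfS
  · exact universalHom_unique f fS hfS g fun r => RingHom.congr_fun hg r

/-- As `f s` is a unit, `f s * b = f a` determines `b`; this evaluates `j` and `σ'` on fractions. -/
theorem map_oreDiv_eq {f : R →+* T} {g : OreLocalization S R →+* T}
    (hg : g.comp numeratorRingHom = f) {a : R} {s : S} {b : T} (h : f s * b = f a) :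
    g (a /ₒ s) = b := by
  subst hg
  refine ((isUnit_numeratorRingHom s).map g).mul_left_cancel ?_
  rw [← map_mul, numeratorRingHom_mul_oreDiv]
  exact h.symm

theorem numeratorRingHom_injective (h : ∀ s ∈ S, ∀ a : R, s * a = 0 → a = 0) :
    Function.Injective (numeratorRingHom : R →+* OreLocalization S R) :=
  numeratorHom_inj fun s hs a ha => h s hs a ha

/-- Finitely many left fractions have a common denominator. -/
theorem exists_common_denominator {α : Type*} (f : α →₀ OreLocalization S R) :
    ∃ (s : S) (g : α →₀ R), f.mapRange (numeratorRingHom (s : R) * ·) (mul_zero _) =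
      g.mapRange numeratorRingHom (map_zero _) := by
  induction f using Finsupp.induction_linear with
  | zero => exact ⟨1, 0, by simp⟩
  | add f₁ f₂ h₁ h₂ =>
    obtain ⟨s₁, g₁, h₁⟩ := h₁
    obtain ⟨s₂, g₂, h₂⟩ := h₂
    -- By `ore_eq` this equals `oreNum s₁ s₂ * s₂`, so it clears both families.
    refine ⟨oreDenom (s₁ : R) s₂ * s₁, g₁.mapRange ((oreDenom (s₁ : R) s₂ : R) * ·) (mul_zero _) +
      g₂.mapRange (oreNum (s₁ : R) s₂ * ·) (mul_zero _), ?_⟩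
    ext t
    have e₁ := DFunLike.congr_fun h₁ t
    have e₂ := DFunLike.congr_fun h₂ t
    simp only [Finsupp.mapRange_apply] at e₁ e₂
    simp only [Finsupp.mapRange_apply, Finsupp.add_apply, mul_add, map_add, map_mul,
      Submonoid.coe_mul, ← e₁, ← e₂]
    simp only [← mul_assoc, ← map_mul, ore_eq]
  | single t q =>
    obtain ⟨s, a, h⟩ := exists_numeratorRingHom_mul_eq q
    exact ⟨s, Finsupp.single t a, by rw [Finsupp.mapRange_single, Finsupp.mapRange_single, h]⟩

end OreLocalization

/-! ### The extension of `S⁻¹R` inside `S⁻¹A` -/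

section Localization

variable {R A : Type*} [Ring R] [IsDomain R] [Ring A] {n : ℕ} {ι : R →+* A} {x : Fin n → A}

theorem numeratorRingHom_nonzeroElements_injective [OreSet (nonzeroElements R)] : Function.Injective
    (numeratorRingHom : R →+* OreLocalization (nonzeroElements R) R) :=
  numeratorRingHom_injective fun _ hs _ h => (mul_eq_zero.1 h).resolve_left hs

theorem IsQuasiCommSkewPBW.numeratorRingHom_injective [OreSet (nonzeroElementsIn ι)]
    (h : IsQuasiCommSkewPBW ι x) :
    Function.Injective (numeratorRingHom : A →+* OreLocalization (nonzeroElementsIn ι) A) := by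
  refine OreLocalization.numeratorRingHom_injective ?_
  rintro _ ⟨s, hs, rfl⟩ a ha
  exact h.eq_zero_of_coeff_mul hs ha

variable [OreSet (nonzeroElements R)] [OreSet (nonzeroElementsIn ι)]
  {j : OreLocalization (nonzeroElements R) R →+* OreLocalization (nonzeroElementsIn ι) A}

theorem numeratorRingHom_pbwSum (hj : j.comp numeratorRingHom = numeratorRingHom.comp ι)
    (x : Fin n → A) (f : (Fin n → ℕ) →₀ R) :
    numeratorRingHom (pbwSum ι x f) =
      pbwSum j (fun i => (numeratorRingHom (x i) : OreLocalization (nonzeroElementsIn ι) A))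
        (f.mapRange numeratorRingHom (map_zero _)) := by
  rw [map_pbwSum, ← hj, pbwSum_comp]

/-- Clearing denominators turns a relation over `S⁻¹R` into one over `R`, because `A` embeds in
`S⁻¹A`. -/
theorem IsQuasiCommSkewPBW.pbwSum_localization_injective (h : IsQuasiCommSkewPBW ι x)
    (hj : j.comp numeratorRingHom = numeratorRingHom.comp ι) :
    Function.Injective (pbwSum j fun i =>
      (numeratorRingHom (x i) : OreLocalization (nonzeroElementsIn ι) A)) := by
  rw [injective_iff_map_eq_zero]
  intro f hf
  obtain ⟨s, g, hg⟩ := exists_common_denominator f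
  have h0 : g = 0 := by
    refine h.pbwSum_injective (h.numeratorRingHom_injective ?_)
    rw [numeratorRingHom_pbwSum hj, ← hg, ← mul_pbwSum, hf, mul_zero, map_zero, map_zero]
  ext t
  have := DFunLike.congr_fun hg t
  rw [h0] at this
  simp only [Finsupp.mapRange_apply, Finsupp.coe_zero, Pi.zero_apply, map_zero] at this
  exact (isUnit_numeratorRingHom s).mul_right_eq_zero.1 this

theorem IsQuasiCommSkewPBW.pbwSum_localization_surjective (h : IsQuasiCommSkewPBW ι x)
    (hj : j.comp numeratorRingHom = numeratorRingHom.comp ι) :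
    Function.Surjective (pbwSum j fun i =>
      (numeratorRingHom (x i) : OreLocalization (nonzeroElementsIn ι) A)) := by
  intro l
  induction l with | _ a s
  obtain ⟨_, s, hs, rfl⟩ := s
  obtain ⟨f, rfl⟩ := h.pbwSum_surjective a
  obtain ⟨u, hu⟩ := isUnit_numeratorRingHom (⟨s, hs⟩ : nonzeroElements R)
  refine ⟨(f.mapRange numeratorRingHom (map_zero _)).mapRange (↑u⁻¹ * ·) (mul_zero _), ?_⟩
  rw [← mul_pbwSum, ← numeratorRingHom_pbwSum hj]
  refine (isUnit_numeratorRingHom (inclDenom ι ⟨s, hs⟩)).mul_left_cancel ?_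
  have hus : numeratorRingHom (ι s) = j u := by
    rw [hu]; exact (RingHom.congr_fun hj s).symm
  refine Eq.trans ?_ (numeratorRingHom_mul_oreDiv _ (inclDenom ι ⟨s, hs⟩)).symm
  rw [inclDenom, hus, ← mul_assoc, ← map_mul, Units.mul_inv, map_one, one_mul]

theorem HasPBWParameters.localization {σ : Fin n → R →+* R} {c : Fin n → Fin n → R}
    (hp : HasPBWParameters ι x σ c) (hj : j.comp numeratorRingHom = numeratorRingHom.comp ι)
    {σ' : Fin n → OreLocalization (nonzeroElements R) R →+* OreLocalization (nonzeroElements R) R}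
    (hσ' : ∀ i, (σ' i).comp numeratorRingHom = numeratorRingHom.comp (σ i)) :
    HasPBWParameters j (fun i => (numeratorRingHom (x i) : OreLocalization (nonzeroElementsIn ι) A))
      σ' (fun k i => numeratorRingHom (c k i)) where
  endo_injective i := by
    rw [injective_iff_map_eq_zero]
    intro q hq
    obtain ⟨s, a, hsa⟩ := exists_numeratorRingHom_mul_eq q
    have h0 : numeratorRingHom (σ i a) = (0 : OreLocalization (nonzeroElements R) R) := by
      refine (RingHom.congr_fun (hσ' i) a).symm.trans ?_
      rw [RingHom.comp_apply, ← hsa, map_mul, hq, mul_zero]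
    rw [map_eq_zero_iff _ numeratorRingHom_nonzeroElements_injective,
      map_eq_zero_iff _ (hp.endo_injective i)] at h0
    rw [h0, map_zero] at hsa
    exact (isUnit_numeratorRingHom s).mul_right_eq_zero.1 hsa
  mul_coeff i q := by
    have key : ∀ a : R, numeratorRingHom (x i) * j (numeratorRingHom a) =
        j (σ' i (numeratorRingHom a)) * numeratorRingHom (x i) := by
      intro a
      have h1 : ∀ a, j (numeratorRingHom a) = numeratorRingHom (ι a) := RingHom.congr_fun hj
      have h2 : ∀ a, σ' i (numeratorRingHom a) = numeratorRingHom (σ i a) :=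
        RingHom.congr_fun (hσ' i)
      rw [h2, h1, h1, ← map_mul, ← map_mul, hp.mul_coeff]
    obtain ⟨s, a, hsa⟩ := exists_numeratorRingHom_mul_eq q
    -- With `s q = a`, both sides times `j (σ'_i s)` become the rule for the numerator `a`.
    refine (((isUnit_numeratorRingHom s).map (σ' i)).map j).mul_left_cancel ?_
    rw [← mul_assoc, ← key, mul_assoc, ← map_mul, hsa, key, ← hsa, map_mul, map_mul, mul_assoc]
  const_ne_zero k i := by
    rw [Ne, map_eq_zero_iff _ numeratorRingHom_nonzeroElements_injective]
    exact hp.const_ne_zero k i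
  mul_var k i := by
    have h1 : ∀ a, j (numeratorRingHom a) = numeratorRingHom (ι a) := RingHom.congr_fun hj
    rw [h1, ← map_mul, hp.mul_var, map_mul, map_mul]

/-- The localization `S⁻¹A` is a quasi-commutative skew PBW extension of `S⁻¹R`. -/
theorem IsQuasiCommSkewPBW.localization (h : IsQuasiCommSkewPBW ι x)
    {σ : Fin n → R →+* R} {c : Fin n → Fin n → R}
    (hp : HasPBWParameters ι x σ c) (hj : j.comp numeratorRingHom = numeratorRingHom.comp ι)
    {σ' : Fin n → OreLocalization (nonzeroElements R) R →+* OreLocalization (nonzeroElements R) R}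
    (hσ' : ∀ i, (σ' i).comp numeratorRingHom = numeratorRingHom.comp (σ i)) :
    IsQuasiCommSkewPBW j
      (fun i => (numeratorRingHom (x i) : OreLocalization (nonzeroElementsIn ι) A)) := by
  have hp' := hp.localization hj hσ'
  have hinj := h.pbwSum_localization_injective hj
  refine ⟨?_, (linearIndependent_pbwMonomial_iff _ _).2
    ((injective_iff_map_eq_zero _).1 hinj), (span_pbwMonomial_iff _ _).2
    (h.pbwSum_localization_surjective hj), fun i r hr => ⟨σ' i r, ?_, hp'.mul_coeff i r⟩,
    fun i k => ⟨_, hp'.const_ne_zero k i, hp'.mul_var k i⟩⟩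
  · intro a b hab
    refine Finsupp.single_injective 0 (hinj ?_)
    rw [pbwSum_single, pbwSum_single, hab]
  · rwa [Ne, map_eq_zero_iff _ (hp'.endo_injective i)]

end Localization

theorem mainTheorem6 {R : Type*} {A : Type*} [Ring R] [IsLeftOreDomain R] [Ring A]
    {n : ℕ} (ι : R →+* A) (x : Fin n → A) (hA : IsQuasiCommSkewPBW ι x) :
    -- the rings of fractions exist: `S = R ∖ {0}` is a left Ore set in `R` and in `A`
    Nonempty (OreSet (nonzeroElements R)) ∧ Nonempty (OreSet (nonzeroElementsIn ι)) ∧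
    -- the endomorphisms `σ_i` and the constants `c_{j,i}` of `A`
    ∃ (σ : Fin n → R →+* R) (c : Fin n → Fin n → R) (hσc : HasPBWParameters ι x σ c),
    ∀ [OreSet (nonzeroElements R)] [OreSet (nonzeroElementsIn ι)],
    -- the canonical map `ψ : A → S⁻¹A` has the universal property of `S⁻¹A`
    (∀ s ∈ nonzeroElementsIn ι,
      IsUnit ((numeratorRingHom : A →+* OreLocalization (nonzeroElementsIn ι) A) s)) ∧
    (∀ (T : Type*) [Ring T] (f : A →+* T), (∀ s ∈ nonzeroElementsIn ι, IsUnit (f s)) →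
      ∃! g : OreLocalization (nonzeroElementsIn ι) A →+* T, g.comp numeratorRingHom = f) ∧
    -- the inclusion `j` of `S⁻¹R` in `S⁻¹A`, and the endomorphisms `σ̄_i` of `S⁻¹R`
    ∃ (j : OreLocalization (nonzeroElements R) R →+* OreLocalization (nonzeroElementsIn ι) A)
      (σ' : Fin n → OreLocalization (nonzeroElements R) R →+*
        OreLocalization (nonzeroElements R) R),
      (∀ (a : R) (s : nonzeroElements R), j (a /ₒ s) = ι a /ₒ inclDenom ι s) ∧
      (∀ (i : Fin n) (a : R) (s : nonzeroElements R),
        σ' i (a /ₒ s) = σ i a /ₒ endoDenom (σ i) (hσc.endo_injective i) s) ∧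
      -- `S⁻¹A` is a quasi-commutative skew PBW extension of `S⁻¹R` with endomorphisms `σ̄_i`
      IsQuasiCommSkewPBW j (fun i => x i /ₒ (1 : nonzeroElementsIn ι)) ∧
      HasPBWParameters j (fun i => x i /ₒ (1 : nonzeroElementsIn ι)) σ'
        (fun k i => c k i /ₒ (1 : nonzeroElements R)) ∧
      -- `ψ (∑ a_t x^t) = ∑ (a_t / 1) x^t`
      (∀ a : (Fin n → ℕ) →₀ R,
        numeratorRingHom (a.sum fun t r => ι r * pbwMonomial x t) =
          a.sum fun t r => j (r /ₒ (1 : nonzeroElements R)) *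
            pbwMonomial (fun i => x i /ₒ (1 : nonzeroElementsIn ι)) t) ∧
      -- every quasi-commutative skew PBW extension of `S⁻¹R` in `y_1, …, y_n` with the
      -- endomorphisms `σ̄_i` and the constants `c_{j,i} / 1` is isomorphic to `S⁻¹A`, by a unique
      -- isomorphism over `S⁻¹R` that takes `x_i / 1` to `y_i`
      (∀ (B : Type*) [Ring B] (k : OreLocalization (nonzeroElements R) R →+* B) (y : Fin n → B),
        IsQuasiCommSkewPBW k y →
        HasPBWParameters k y σ' (fun l i => c l i /ₒ (1 : nonzeroElements R)) →
        ∃! Φ : OreLocalization (nonzeroElementsIn ι) A ≃+* B,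
          (∀ q, Φ (j q) = k q) ∧ ∀ i, Φ (x i /ₒ (1 : nonzeroElementsIn ι)) = y i) := by
  obtain ⟨σ, c, hσc⟩ := hA.exists_parameters
  refine ⟨nonempty_oreSet_nonzeroElements R, hA.nonempty_oreSet hσc, σ, c, hσc, ?_⟩
  intro _ _
  have hunit : ∀ s ∈ nonzeroElementsIn ι,
      IsUnit ((numeratorRingHom : A →+* OreLocalization (nonzeroElementsIn ι) A) s) :=
    fun s hs => isUnit_numeratorRingHom ⟨s, hs⟩
  refine ⟨hunit, fun T _ f hf => existsUnique_comp_numeratorRingHom f hf, ?_⟩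
  obtain ⟨j, hj, -⟩ := existsUnique_comp_numeratorRingHom (S := nonzeroElements R)
    ((numeratorRingHom : A →+* OreLocalization (nonzeroElementsIn ι) A).comp ι)
    fun s hs => hunit _ (Submonoid.mem_map_of_mem ι hs)
  choose σ' hσ' _ using fun i => existsUnique_comp_numeratorRingHom (S := nonzeroElements R)
    ((numeratorRingHom : R →+* OreLocalization (nonzeroElements R) R).comp (σ i))
    fun s hs => isUnit_numeratorRingHom (endoDenom (σ i) (hσc.endo_injective i) ⟨s, hs⟩)
  -- `x i /ₒ 1` is `numeratorRingHom (x i)` by definition, so these fit the goal unchanged.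
  have hL := hA.localization hσc hj hσ'
  have hLp := hσc.localization hj hσ'
  refine ⟨j, σ', fun a s => map_oreDiv_eq hj (numeratorRingHom_mul_oreDiv (ι a) (inclDenom ι s)),
    fun i a s => map_oreDiv_eq (hσ' i)
      (numeratorRingHom_mul_oreDiv (σ i a) (endoDenom (σ i) (hσc.endo_injective i) s)),
    hL, hLp, fun a => ?_, fun B _ k y hy hyp => hL.existsUnique_ringEquiv hy hLp hyp⟩
  refine (numeratorRingHom_pbwSum hj x a).trans ?_
  rw [pbwSum_apply, Finsupp.sum_mapRange_index (by simp)]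
  rfl
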